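/- Let $d\ge 1$ and let $\mathbb X$ be the space of simple point measures on $\mathbb R^d$, i.e. sums $\sum_{x\in S}\delta_x$ over countable sets $S\subset\mathbb R^d$ (not necessarily locally finite), with the smallest $\sigma$-algebra making all maps $\mu\mapsto\mu(B)$, $B\subset\mathbb R^d$ Borel, measurable. An isometry $\theta$ of $\mathbb R^d$ acts on $\mathbb X$ by $(\theta\mu)(A)=\mu(\theta^{-1}(A))$. Let $\mathfrak F$ be the set of closed subsets of $\mathbb R^d$ with the Effros $\sigma$-algebra, i.e. the one generated by the sets $\{F\in\mathfrak F: F\cap K\neq\emptyset\}$ for compact $K\subset\mathbb R^d$. Let $\bar B(x,r)$ denote the closed Euclidean ball of radius $r$ about $x$. For $R>0$, an $R$-selection rule is a map $\Psi:\mathbb X\to\mathfrak F$ such that (a) for every $\lambda>0$, if $X$ is a homogeneous Poisson point process on $\mathbb R^d$ with intensity $\lambda$, then almost surely $\Psi(X)$ is a non-empty union of pairwise disjoint closed balls of radius $R$; (b) $\Psi(\theta\mu)=\theta\Psi(\mu)$ for all isometries $\theta$ of $\mathbb R^d$ and all $\mu\in\mathbb X$; (c) for all $\mu,\mu'\in\mathbb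 X$, if $\mu$ and $\mu'$ have the same restriction to $H(\mu):=\big(\bigcup_{x\in\Psi(\mu)}\bar B(x,2)\big)^c$, then $\Psi(\mu)=\Psi(\mu')$; (d) $\Psi$ is measurable. **Proposition.** For all $d\ge 1$ and all $R>0$, there exists an $R$-selection rule. -/

import Mathlib

open MeasureTheory
open scoped ENNReal NNReal

noncomputable section

namespace PointProc

/-- Euclidean space `ℝ^d` with its Euclidean norm. -/
abbrev Space (d : ℕ) : Type := EuclideanSpace ℝ (Fin d)

/-- A simple point measure on `ℝ^d`: a sum `∑ x ∈ S, δ_x` of unit point masses over a countable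
set `S` of (distinct) points, i.e. the counting measure restricted to `S`.
No local finiteness is required, so the locally finite configurations are included. -/
def IsSimplePointMeasure {d : ℕ} (μ : Measure (Space d)) : Prop :=
  ∃ S : Set (Space d), S.Countable ∧ μ = Measure.count.restrict S

/-- The space of all simple point measures on `ℝ^d`. As a subtype of `Measure (Space d)` it carries
the smallest `σ`-algebra for which all evaluations `μ ↦ μ B`, with `B` Borel, are measurable. -/
abbrev Config (d : ℕ) : Type := {μ : Measure (Space d) // IsSimplePointMeasure μ}

/-- The image of a simple point measure under an isometry is a simple point measure. -/
theorem IsSimplePointMeasure.map {d : ℕ} {μ : Measure (Space d)} (h : IsSimplePointMeasure μ)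
    (θ : Space d ≃ᵢ Space d) : IsSimplePointMeasure (μ.map θ) := by
  obtain ⟨S, hS, rfl⟩ := h
  have hθ : Measurable θ := θ.continuous.measurable
  refine ⟨θ '' S, hS.image _, ?_⟩
  ext B hB
  rw [Measure.map_apply hθ hB, Measure.restrict_apply (hθ hB), Measure.restrict_apply hB,
    Measure.count_apply ((hθ hB).inter hS.measurableSet),
    Measure.count_apply (hB.inter (hS.image _).measurableSet),
    ← Set.image_preimage_inter, θ.injective.encard_image]

/-- The action of an isometry on configurations: `(θ μ)(A) = μ (θ⁻¹ A)`. -/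
def Config.map {d : ℕ} (θ : Space d ≃ᵢ Space d) (μ : Config d) : Config d :=
  ⟨μ.1.map θ, μ.2.map θ⟩

/-- `P` is the law of a homogeneous Poisson point process on `ℝ^d` with intensity `lam`: the number
of points in a Borel set `B` of finite volume is Poisson distributed with mean `lam * vol B`, and
the numbers of points in finitely many pairwise disjoint Borel sets are independent. -/
structure IsPoissonLaw {d : ℕ} (lam : ℝ≥0) (P : Measure (Config d)) : Prop where
  isProbabilityMeasure : IsProbabilityMeasure P
  map_count : ∀ B : Set (Space d), MeasurableSet B → volume B ≠ ∞ →
    P.map (fun μ : Config d => μ.1 B) =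
      (ProbabilityTheory.poissonMeasure (lam * (volume B).toNNReal)).map (Nat.cast : ℕ → ℝ≥0∞)
  indep : ∀ (n : ℕ) (B : Fin n → Set (Space d)), (∀ i, MeasurableSet (B i)) →
    Pairwise (fun i j => Disjoint (B i) (B j)) →
    ProbabilityTheory.iIndepFun (fun (i : Fin n) (μ : Config d) => μ.1 (B i)) P

/-- The closed subsets of `ℝ^d`. -/
abbrev ClosedSets (d : ℕ) : Type := TopologicalSpace.Closeds (Space d)

/-- The Effros `σ`-algebra, generated by the sets `{F | F ∩ K ≠ ∅}` with `K` compact. -/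
instance effros (d : ℕ) : MeasurableSpace (ClosedSets d) :=
  MeasurableSpace.generateFrom
    {A | ∃ K : Set (Space d), IsCompact K ∧
      A = {F : ClosedSets d | ((F : Set (Space d)) ∩ K).Nonempty}}

/-- The complement of the union of the closed balls of radius `2` centred at points of `F`. -/
def outside {d : ℕ} (F : ClosedSets d) : Set (Space d) :=
  (⋃ x ∈ (F : Set (Space d)), Metric.closedBall x 2)ᶜ

/-- An `R`-selection rule. -/
structure IsSelectionRule {d : ℕ} (R : ℝ) (Ψ : Config d → ClosedSets d) : Prop where
  /-- Under every Poisson law of positive intensity, almost surely the selected set is a nonempty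
  union of pairwise disjoint closed balls of radius `R`. -/
  globes : ∀ lam : ℝ≥0, 0 < lam → ∀ P : Measure (Config d), IsPoissonLaw lam P →
    ∀ᵐ μ ∂P, ∃ C : Set (Space d), C.Nonempty ∧
      C.PairwiseDisjoint (fun c => Metric.closedBall c R) ∧
      (Ψ μ : Set (Space d)) = ⋃ c ∈ C, Metric.closedBall c R
  equivariant : ∀ (θ : Space d ≃ᵢ Space d) (μ : Config d),
    (Ψ (μ.map θ) : Set (Space d)) = θ '' (Ψ μ : Set (Space d))
  /-- If two configurations agree outside the `2`-neighbourhood of the set selected under the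
  first, then the same set is selected under both. -/
  determined : ∀ μ μ' : Config d,
    μ.1.restrict (outside (Ψ μ)) = μ'.1.restrict (outside (Ψ μ)) → Ψ μ = Ψ μ'
  measurable : Measurable Ψ

end PointProc

end

noncomputable section

namespace PointProc

open ProbabilityTheory Set Filter Topology Metric

variable {d : ℕ} {ρ a b T r ε : ℝ} {μ ν : Measure (Space d)} {c c' z : Space d}

/-! With `ρ = R + 2`, a seed is a centre recognised only from the points at distance in `(ρ, T)`: a
thin shell carries `2 * d` points, balanced about the centre and spread over all directions, and the
rest of this annulus is empty. The selected set is the union of the balls of radius `R` about the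
seeds. The crux is `Admissible.le_dist_of_ne`: distinct seeds are at distance at least `T + ρ`.
Nearby seeds share their shell points, hence their barycentre; at any other distance below `T + ρ`,
the spread condition puts a shell point of one seed into the empty region of the other. So the
annulus of a seed avoids the `ρ`-balls about all seeds, which are exactly what `outside` removes,
and this yields property (c) (`Admissible.selection_determined`). Being a seed is isometry
invariant, which gives equivariance. Measurability holds because near a given point the only
candidate is a barycentre depending measurably on the configuration. Seeds exist almost surely: a
perturbed cross-polytope with otherwise empty surroundings produces one
(`Admissible.exists_isSeed_of_pattern`), and independence in disjoint windows makes this pattern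
occur somewhere (`IsPoissonLaw.ae_exists_patternEvent`). -/

/-! ### Seeds -/

/-- The closed spherical shell about `c` with radii `a ≤ b`. -/
def shell {d : ℕ} (a b : ℝ) (c : Space d) : Set (Space d) := {x | dist x c ∈ Icc a b}

/-- The points at distance in `(ρ, T)` from `c` that do not lie in the shell with radii `a ≤ b`. -/
def moat {d : ℕ} (ρ a b T : ℝ) (c : Space d) : Set (Space d) := {x | dist x c ∈ Ioo ρ T \ Icc a b}

/-- The points whose displacement from `c` has a large component in direction `v`. -/
def cap {d : ℕ} (ρ : ℝ) (c v : Space d) : Set (Space d) := {x | 2 * ρ * ‖v‖ ≤ inner ℝ (x - c) v}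

/-- The point `c` is a seed of `μ`: the points of `μ` at distance in `(ρ, T)` from `c` all lie in
the shell with radii `a ≤ b`, there are `2 * d` of them, their barycentre is `c`, and every
direction is well approximated by one of them. -/
structure IsSeed {d : ℕ} (ρ a b T : ℝ) (μ : Measure (Space d)) (c : Space d) : Prop where
  moat_null : μ (moat ρ a b T c) = 0
  shell_mass : μ (shell a b c) = 2 * d
  balanced : ∫ x in shell a b c, (x - c) ∂μ = 0
  spread : ∀ v, μ (shell a b c ∩ cap ρ c v) ≠ 0

/-- Radii for which distinct seeds are far apart. -/
structure Admissible (ρ a b T : ℝ) : Prop where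
  pos : 0 < ρ
  two_mul_le : 2 * ρ ≤ a
  le : a ≤ b
  thin : b ^ 2 - a ^ 2 ≤ (ρ / 4) ^ 2
  four_mul_le : 4 * b ≤ T
  sq_le : b ^ 2 ≤ ρ * T

/-! ### Uniqueness and separation of seeds -/

theorem isClosed_shell (a b : ℝ) (c : Space d) : IsClosed (shell a b c) :=
  isClosed_Icc.preimage (by fun_prop)

theorem measurableSet_shell (a b : ℝ) (c : Space d) : MeasurableSet (shell a b c) :=
  (isClosed_shell a b c).measurableSet

theorem isOpen_moat (ρ a b T : ℝ) (c : Space d) : IsOpen (moat ρ a b T c) :=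
  (isOpen_Ioo.sdiff isClosed_Icc).preimage (by fun_prop)

theorem isClosed_cap (ρ : ℝ) (c v : Space d) : IsClosed (cap ρ c v) :=
  isClosed_le (by fun_prop) (by fun_prop)

/-- Widening the shell by `ρ / 4` absorbs the change of centre, and the excess falls into the empty
moat of `c`. The point is that the widened shell does not depend on `c`. -/
theorem Admissible.shell_ae_eq (h : Admissible ρ a b T) (hc : dist c c' ≤ ρ / 4)
    (h0 : μ (moat ρ a b T c) = 0) :
    shell (a - ρ / 4) (b + ρ / 4) c' =ᵐ[μ] shell a b c := by
  obtain ⟨h1, h2, h3, -, h5, -⟩ := h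
  refine ae_eq_set.2 ⟨measure_mono_null ?_ h0, ?_⟩
  · rintro x ⟨⟨hx1, hx2⟩, hx⟩
    have := dist_triangle x c c'
    have := dist_triangle x c' c
    rw [dist_comm c' c] at this
    exact ⟨⟨by linarith, by linarith⟩, hx⟩
  · rw [sdiff_eq_empty.2, measure_empty]
    rintro x ⟨hx1, hx2⟩
    have := dist_triangle x c c'
    have := dist_triangle x c' c
    rw [dist_comm c' c] at this
    exact ⟨by linarith, by linarith⟩

theorem integrableOn_id_of_isBounded {s : Set (Space d)} (hs : Bornology.IsBounded s)
    (hsm : MeasurableSet s) (hfin : μ s ≠ ∞) : IntegrableOn (fun x : Space d => x) s μ := by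
  obtain ⟨M, hM⟩ := hs.exists_norm_le
  exact Measure.integrableOn_of_bounded (M := M) hfin (by fun_prop)
    ((ae_restrict_iff' hsm).2 (ae_of_all _ hM))

theorem setIntegral_sub_eq_zero_iff {s : Set (Space d)} (hs : Bornology.IsBounded s)
    (hsm : MeasurableSet s) (hμ : μ s = 2 * d) (c : Space d) :
    ∫ x in s, (x - c) ∂μ = 0 ↔ ∫ x in s, x ∂μ = (2 * d : ℝ) • c := by
  have hfin : μ s ≠ ∞ := by rw [hμ]; exact ENNReal.mul_ne_top (by simp) (by simp)
  rw [integral_sub (integrableOn_id_of_isBounded hs hsm hfin) (integrableOn_const hfin), sub_eq_zero, setIntegral_const,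
    measureReal_def, hμ]
  simp

/-- This trades the shell about the unknown `c` for one about a reference point `c'`, so that the
balance condition becomes an explicit formula for `c`. Both uniqueness and measurability rest on it.
-/
theorem Admissible.isSeed_iff (h : Admissible ρ a b T) (hc : dist c c' ≤ ρ / 4) :
    IsSeed ρ a b T μ c ↔ μ (moat ρ a b T c) = 0 ∧
      μ (shell (a - ρ / 4) (b + ρ / 4) c') = 2 * d ∧
      ∫ x in shell (a - ρ / 4) (b + ρ / 4) c', x ∂μ = (2 * d : ℝ) • c ∧
      ∀ v, μ (shell (a - ρ / 4) (b + ρ / 4) c' ∩ cap ρ c v) ≠ 0 := by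
  have hb : Bornology.IsBounded (shell a b c) :=
    isBounded_closedBall.subset fun x hx => mem_closedBall.2 hx.2
  constructor
  · rintro ⟨h0, h1, h2, h3⟩
    have hae := h.shell_ae_eq hc h0
    refine ⟨h0, (measure_congr hae).trans h1, ?_, fun v => ?_⟩
    · rw [setIntegral_congr_set hae]
      exact (setIntegral_sub_eq_zero_iff hb (measurableSet_shell _ _ _) h1 c).1 h2
    · have hv : μ (shell (a - ρ / 4) (b + ρ / 4) c' ∩ cap ρ c v) = μ (shell a b c ∩ cap ρ c v) :=
        measure_congr (hae.inter (ae_eq_refl _))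
      exact hv ▸ h3 v
  · rintro ⟨h0, h1, h2, h3⟩
    have hae := h.shell_ae_eq hc h0
    have h1' := (measure_congr hae).symm.trans h1
    refine ⟨h0, h1', ?_, fun v => ?_⟩
    · refine (setIntegral_sub_eq_zero_iff hb (measurableSet_shell _ _ _) h1' c).2 ?_
      rw [← setIntegral_congr_set hae, h2]
    · have hv : μ (shell (a - ρ / 4) (b + ρ / 4) c' ∩ cap ρ c v) = μ (shell a b c ∩ cap ρ c v) :=
        measure_congr (hae.inter (ae_eq_refl _))
      exact hv ▸ h3 v

theorem Admissible.seed_eq_of_dist_le (h : Admissible ρ a b T) (hd : 1 ≤ d)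
    (hs : IsSeed ρ a b T μ c) (hs' : IsSeed ρ a b T μ c') (hc : dist c c' ≤ ρ / 4) : c = c' := by
  have h1 := ((h.isSeed_iff hc).1 hs).2.2.1
  have h2 := ((h.isSeed_iff (by rw [dist_self]; linarith [h.pos])).1 hs').2.2.1
  have hd' : (0 : ℝ) < d := by exact_mod_cast hd
  exact smul_right_injective _ (by positivity : (2 * d : ℝ) ≠ 0) (h1.symm.trans h2)

/-- Distinct seeds are at distance at least `T + ρ`. -/
theorem Admissible.le_dist_of_ne (h : Admissible ρ a b T) (hd : 1 ≤ d)
    (hs : IsSeed ρ a b T μ c) (hs' : IsSeed ρ a b T μ c') (hne : c ≠ c') :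
    T + ρ ≤ dist c c' := by
  by_contra! hlt
  have hgt : ρ / 4 < dist c c' := by
    by_contra! hle
    exact hne (h.seed_eq_of_dist_le hd hs hs' hle)
  obtain ⟨h1, h2, h3, h4, h5, h6⟩ := h
  rw [dist_eq_norm] at hlt hgt
  have key : ∀ x : Space d, dist x c ^ 2 =
      dist x c' ^ 2 + ‖c - c'‖ ^ 2 - 2 * inner ℝ (x - c') (c - c') := fun x => by
    rw [dist_eq_norm, dist_eq_norm, ← sub_sub_sub_cancel_right x c c', norm_sub_sq_real]
    ring
  rcases lt_or_ge ‖c - c'‖ (T - b) with hD | hD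
  -- Moderate distance: take a shell point of `c'` on the side facing away from `c`. Its squared
  -- distance to `c` is at least `a ^ 2 + ‖c - c'‖ ^ 2`, which exceeds `b ^ 2` by thinness, and the
  -- triangle inequality keeps it within `T`: it lies in the moat of `c`.
  · refine hs'.spread (c' - c) (measure_mono_null ?_ hs.moat_null)
    rintro x ⟨⟨hx1, hx2⟩, hx⟩
    have hx : 2 * ρ * ‖c' - c‖ ≤ inner ℝ (x - c') (c' - c) := hx
    rw [← neg_sub c c', inner_neg_right, norm_neg] at hx
    have hk := key x
    have ht : dist x c ≤ b + ‖c - c'‖ := by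
      have := dist_triangle x c' c
      rw [dist_comm c' c, dist_eq_norm c c'] at this
      linarith
    have hpos : 0 ≤ ρ * ‖c - c'‖ := by positivity
    have hb : b < dist x c := by
      refine lt_of_pow_lt_pow_left₀ 2 dist_nonneg ?_
      nlinarith
    exact ⟨⟨by linarith, by linarith⟩, fun hh => absurd hh.2 (not_le.2 hb)⟩
  -- Large distance: take a shell point of `c'` on the side facing `c`. The gain `4 * ρ * ‖c - c'‖`
  -- from the cap, with `b ^ 2 ≤ ρ * T`, pulls it within distance `T` of `c`, even for centres up to
  -- `T + ρ` apart.
  · refine hs'.spread (c - c') (measure_mono_null ?_ hs.moat_null)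
    rintro x ⟨⟨hx1, hx2⟩, hx⟩
    have hx : 2 * ρ * ‖c - c'‖ ≤ inner ℝ (x - c') (c - c') := hx
    have hk := key x
    have ht : ‖c - c'‖ ≤ dist x c + b := by
      have := dist_triangle c x c'
      rw [dist_comm c x, dist_eq_norm c c'] at this
      linarith
    have hb : b < dist x c := by linarith
    have hT : dist x c < T := by
      refine lt_of_pow_lt_pow_left₀ 2 (by linarith) ?_
      have hx3 : dist x c' ^ 2 ≤ b ^ 2 := pow_le_pow_left₀ dist_nonneg hx2 2
      nlinarith [mul_nonneg (sub_nonneg.2 hD) (sub_nonneg.2 hlt.le), mul_pos h1 h1]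
    exact ⟨⟨by linarith, hT⟩, fun hh => absurd hh.2 (not_le.2 hb)⟩

/-! ### Locality and isometry invariance -/

theorem IsSeed.congr (ha : ρ < a) (hb : b < T) (hs : IsSeed ρ a b T μ c) {H : Set (Space d)}
    (hH : {x | dist x c ∈ Ioo ρ T} ⊆ H) (hμ : μ.restrict H = ν.restrict H) :
    IsSeed ρ a b T ν c := by
  have hm : ∀ s ⊆ {x | dist x c ∈ Ioo ρ T}, μ.restrict s = ν.restrict s := fun s hs => by
    rw [← Measure.restrict_restrict_of_subset (hs.trans hH), hμ,
      Measure.restrict_restrict_of_subset (hs.trans hH)]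
  have hm' : ∀ s ⊆ {x | dist x c ∈ Ioo ρ T}, ν s = μ s := fun s hs => by
    rw [← Measure.restrict_apply_self, ← hm s hs, Measure.restrict_apply_self]
  have hsh : shell a b c ⊆ {x | dist x c ∈ Ioo ρ T} := fun x hx =>
    ⟨ha.trans_le hx.1, hx.2.trans_lt hb⟩
  refine ⟨?_, ?_, ?_, fun v => ?_⟩
  · rw [hm' _ fun x hx => hx.1]; exact hs.moat_null
  · rw [hm' _ hsh]; exact hs.shell_mass
  · rw [← hm _ hsh]; exact hs.balanced
  · rw [hm' _ (inter_subset_left.trans hsh)]; exact hs.spread v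

theorem IsSeed.map (hs : IsSeed ρ a b T μ c) (θ : Space d ≃ᵢ Space d) :
    IsSeed ρ a b T (μ.map θ) (θ c) := by
  have hθ : MeasurableEmbedding θ := θ.toHomeomorph.measurableEmbedding
  have hL : ∀ x y, θ x - θ y = θ.toRealLinearIsometryEquiv (x - y) := fun x y => by
    simp [map_sub, IsometryEquiv.toRealLinearIsometryEquiv_apply]
  have hshell : θ ⁻¹' shell a b (θ c) = shell a b c := by
    ext x; simp [shell, θ.isometry.dist_eq]
  have hmoat : θ ⁻¹' moat ρ a b T (θ c) = moat ρ a b T c := by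
    ext x; simp [moat, θ.isometry.dist_eq]
  refine ⟨?_, ?_, ?_, fun v => ?_⟩
  · rw [hθ.map_apply, hmoat]; exact hs.moat_null
  · rw [hθ.map_apply, hshell]; exact hs.shell_mass
  · rw [hθ.setIntegral_map, hshell]
    simp_rw [hL]
    rw [← LinearIsometryEquiv.coe_toContinuousLinearEquiv,
      ContinuousLinearEquiv.integral_comp_comm, hs.balanced, map_zero]
  · have hcap : θ ⁻¹' cap ρ (θ c) v = cap ρ c (θ.toRealLinearIsometryEquiv.symm v) := by
      ext x
      simp only [cap, mem_preimage, Set.mem_ofPred_eq, hL, LinearIsometryEquiv.norm_map]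
      rw [← LinearIsometryEquiv.inner_map_map θ.toRealLinearIsometryEquiv (x - c),
        LinearIsometryEquiv.apply_symm_apply]
    rw [hθ.map_apply, preimage_inter, hshell, hcap]
    exact hs.spread _

theorem isSeed_map_iff (θ : Space d ≃ᵢ Space d) :
    IsSeed ρ a b T (μ.map θ) c ↔ IsSeed ρ a b T μ (θ.symm c) := by
  refine ⟨fun h => ?_, fun h => by simpa using h.map θ⟩
  have := h.map θ.symm
  rwa [Measure.map_map θ.symm.continuous.measurable θ.continuous.measurable,
    IsometryEquiv.symm_comp_self, Measure.map_id] at this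

/-! ### Measurability of the presence of seeds -/

/-- Only finitely many points lie in `s`, so this is a finite union of closed conditions on `v`. It
allows the spread condition to be tested on a countable dense set of directions. -/
theorem IsSimplePointMeasure.isClosed_setOf_cap (hμ : IsSimplePointMeasure μ) {s : Set (Space d)}
    (hs : MeasurableSet s) (hfin : μ s ≠ ∞) (ρ : ℝ) (c : Space d) :
    IsClosed {v | μ (s ∩ cap ρ c v) ≠ 0} := by
  obtain ⟨S, hS, rfl⟩ := hμ
  rw [Measure.restrict_apply hs, Measure.count_apply (hs.inter hS.measurableSet),
    ENat.toENNReal_ne_top, encard_ne_top_iff] at hfin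
  have : {v | Measure.count.restrict S (s ∩ cap ρ c v) ≠ 0} =
      ⋃ x ∈ s ∩ S, {v | 2 * ρ * ‖v‖ ≤ inner ℝ (x - c) v} := by
    ext v
    rw [Set.mem_ofPred_eq, Measure.restrict_apply (hs.inter (isClosed_cap ρ c v).measurableSet),
      Ne, Measure.count_eq_zero_iff, ← Ne, ← nonempty_iff_ne_empty]
    simp only [mem_iUnion, exists_prop]
    exact ⟨fun ⟨x, ⟨h1, h2⟩, h3⟩ => ⟨x, ⟨h1, h3⟩, h2⟩, fun ⟨x, ⟨h1, h3⟩, h2⟩ => ⟨x, ⟨h1, h2⟩, h3⟩⟩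
  rw [this]
  exact hfin.isClosed_biUnion fun x _ => isClosed_le (by fun_prop) (by fun_prop)

theorem isOpen_setOf_closure_subset_moat (ρ a b T : ℝ) (U : Set (Space d)) :
    IsOpen {c | closure U ⊆ moat ρ a b T c} := by
  rw [isOpen_iff_eventually]
  intro c hc
  have hK : IsCompact (closure U) := isCompact_of_isClosed_isBounded isClosed_closure
    (isBounded_ball.subset fun x hx => mem_ball.2 (hc hx).1.2)
  have hO : IsOpen {p : Space d × Space d | dist p.2 p.1 ∈ Ioo ρ T \ Icc a b} :=
    (isOpen_Ioo.sdiff isClosed_Icc).preimage (by fun_prop)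
  exact hK.eventually_forall_of_forall_eventually fun x hx => hO.mem_nhds (hc hx)

/-- Reduces a null condition on a set moving with `c` to countably many fixed sets `U`, each with an
open condition on `c`. -/
theorem moat_null_iff (ρ a b T : ℝ) (μ : Measure (Space d)) (c : Space d) :
    μ (moat ρ a b T c) = 0 ↔ ∀ U ∈ TopologicalSpace.countableBasis (Space d),
      closure U ⊆ moat ρ a b T c → μ U = 0 := by
  refine ⟨fun h U _ hUc => measure_mono_null (subset_closure.trans hUc) h, fun h => ?_⟩
  refine measure_mono_null (t := ⋃ U ∈ {U ∈ TopologicalSpace.countableBasis (Space d) |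
    closure U ⊆ moat ρ a b T c}, U) (fun x hx => ?_) ?_
  · obtain ⟨U, hU, hxU, hUc⟩ := (TopologicalSpace.isBasis_countableBasis (Space d)).exists_closure_subset
      ((isOpen_moat ρ a b T c).mem_nhds hx)
    exact mem_biUnion (⟨hU, hUc⟩ : U ∈ {U ∈ _ | _}) hxU
  · exact (measure_biUnion_null_iff ((TopologicalSpace.countable_countableBasis _).mono
      (sep_subset _ _))).2 fun U hU => h U hU.1 hU.2

theorem measurable_apply {s : Set (Space d)} (hs : MeasurableSet s) :
    Measurable fun μ : Config d => μ.1 s :=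
  (Measure.measurable_coe hs).comp measurable_subtype_coe

theorem measurableSet_moat_null {C : Config d → Space d} (hC : Measurable C) (ρ a b T : ℝ) :
    MeasurableSet {μ : Config d | μ.1 (moat ρ a b T (C μ)) = 0} := by
  simp_rw [moat_null_iff]
  have : {μ : Config d | ∀ U ∈ TopologicalSpace.countableBasis (Space d),
      closure U ⊆ moat ρ a b T (C μ) → μ.1 U = 0} =
      ⋂ U ∈ TopologicalSpace.countableBasis (Space d),
        ((C ⁻¹' {c | closure U ⊆ moat ρ a b T c})ᶜ ∪ {μ | μ.1 U = 0}) := by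
    ext μ
    simp only [mem_iInter, mem_union, mem_compl_iff, ← imp_iff_not_or]
    rfl
  rw [this]
  refine MeasurableSet.biInter (TopologicalSpace.countable_countableBasis _) fun U hU =>
    (hC (isOpen_setOf_closure_subset_moat ρ a b T U).measurableSet).compl.union ?_
  exact measurable_apply
    (TopologicalSpace.isOpen_of_mem_countableBasis hU).measurableSet (measurableSet_singleton 0)

theorem measurable_restrict {s : Set (Space d)} (hs : MeasurableSet s) :
    Measurable fun μ : Config d => μ.1.restrict s := by
  refine Measure.measurable_of_measurable_coe _ fun B hB => ?_
  simp_rw [Measure.restrict_apply hB]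
  exact measurable_apply (hB.inter hs)

open Classical in
/-- Restriction to `s` of the configurations with exactly `n` points in `s`, as a kernel. -/
def restrictKernel {s : Set (Space d)} (hs : MeasurableSet s) (n : ℕ) :
    Kernel (Config d) (Space d) :=
  Kernel.piecewise (measurable_apply hs (measurableSet_singleton (n : ℝ≥0∞)))
    ⟨fun μ => μ.1.restrict s, measurable_restrict hs⟩ 0

theorem restrictKernel_apply {s : Set (Space d)} (hs : MeasurableSet s) {n : ℕ} {μ : Config d}
    (hμ : μ.1 s = n) : restrictKernel hs n μ = μ.1.restrict s :=
  if_pos hμ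

instance {s : Set (Space d)} (hs : MeasurableSet s) (n : ℕ) :
    IsFiniteKernel (restrictKernel hs n) := by
  refine ⟨n, by simp, fun μ => ?_⟩
  by_cases hμ : μ.1 s = n
  · rw [restrictKernel_apply hs hμ, Measure.restrict_apply_univ, hμ]
  · have : restrictKernel hs n μ = 0 := if_neg hμ
    simp [this]

/-- The cap moves with `μ`, so its mass is that of a section of a measurable set under a kernel.
Fixing the number of points in `s` makes this kernel finite, although configurations need not be
locally finite. -/
theorem measurableSet_cap_ne_zero {C : Config d → Space d} (hC : Measurable C)
    {s : Set (Space d)} (hs : MeasurableSet s) (n : ℕ) (ρ : ℝ) (v : Space d) :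
    MeasurableSet {μ : Config d | μ.1 s = n ∧ μ.1 (s ∩ cap ρ (C μ) v) ≠ 0} := by
  have hE : MeasurableSet {p : Config d × Space d | 2 * ρ * ‖v‖ ≤ inner ℝ (p.2 - C p.1) v} :=
    measurableSet_le (by fun_prop) (by fun_prop)
  have hm := Kernel.measurable_kernel_prodMk_left (κ := restrictKernel hs n) hE
  have : {μ : Config d | μ.1 s = n ∧ μ.1 (s ∩ cap ρ (C μ) v) ≠ 0} =
      {μ : Config d | μ.1 s = n} ∩
        (fun μ => restrictKernel hs n μ (Prod.mk μ ⁻¹'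
          {p : Config d × Space d | 2 * ρ * ‖v‖ ≤ inner ℝ (p.2 - C p.1) v})) ⁻¹' {0}ᶜ := by
    ext μ
    refine and_congr_right fun hμ => ?_
    have hcap : μ.1.restrict s (cap ρ (C μ) v) = μ.1 (s ∩ cap ρ (C μ) v) := by
      rw [Measure.restrict_apply (isClosed_cap _ _ _).measurableSet, inter_comm]
    rw [← hcap, ← restrictKernel_apply hs hμ]
    rfl
  rw [this]
  exact (measurable_apply hs (measurableSet_singleton _)).inter
    (hm (measurableSet_singleton _).compl)

/-- By `Admissible.isSeed_iff`, a seed near `c'` must equal the rescaled first moment `C μ` of the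
widened shell. The existential over `c` thus becomes a condition on one measurable map. -/
theorem Admissible.measurableSet_exists_seed_near (h : Admissible ρ a b T) (hd : 1 ≤ d)
    (c' : Space d) {K : Set (Space d)} (hK : MeasurableSet K) :
    MeasurableSet {μ : Config d | ∃ c ∈ K, dist c c' ≤ ρ / 4 ∧ IsSeed ρ a b T μ.1 c} := by
  set A := shell (a - ρ / 4) (b + ρ / 4) c' with hA
  have hAm : MeasurableSet A := measurableSet_shell _ _ _
  let C : Config d → Space d := fun μ => (2 * d : ℝ)⁻¹ • ∫ x in A, x ∂μ.1
  let κ : Kernel (Config d) (Space d) :=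
    ⟨fun μ => μ.1.restrict A, measurable_restrict hAm⟩
  have hC : Measurable C := by
    have : StronglyMeasurable fun μ : Config d => ∫ x, x ∂κ μ :=
      StronglyMeasurable.integral_kernel stronglyMeasurable_id
    exact this.measurable.const_smul (2 * d : ℝ)⁻¹
  have hd' : (2 * d : ℝ) ≠ 0 := by
    have : (0 : ℝ) < d := by exact_mod_cast hd
    positivity
  obtain ⟨D, hDc, hD⟩ := TopologicalSpace.exists_countable_dense (Space d)
  have hfin : ((2 * d : ℕ) : ℝ≥0∞) ≠ ∞ := ENNReal.natCast_ne_top _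
  have : {μ : Config d | ∃ c ∈ K, dist c c' ≤ ρ / 4 ∧ IsSeed ρ a b T μ.1 c} =
      {μ : Config d | μ.1 A = (2 * d : ℕ)} ∩ C ⁻¹' (K ∩ closedBall c' (ρ / 4)) ∩
      {μ : Config d | μ.1 (moat ρ a b T (C μ)) = 0} ∩
      ⋂ v ∈ D, {μ : Config d | μ.1 A = (2 * d : ℕ) ∧ μ.1 (A ∩ cap ρ (C μ) v) ≠ 0} := by
    ext μ
    simp only [mem_inter_iff, mem_iInter]
    constructor
    · rintro ⟨c, hcK, hcc, hs⟩
      obtain ⟨h0, h1, h2, h3⟩ := (h.isSeed_iff hcc).1 hs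
      have hCc : C μ = c := by
        simp only [C, hA]
        rw [h2, inv_smul_smul₀ hd']
      have h1' : μ.1 A = (2 * d : ℕ) := by rw [h1]; push_cast; rfl
      refine ⟨⟨⟨h1', ?_⟩, ?_⟩, fun v _ => ⟨h1', ?_⟩⟩
      · exact ⟨hCc ▸ hcK, hCc ▸ hcc⟩
      · rw [Set.mem_ofPred_eq, hCc]; exact h0
      · exact hCc ▸ h3 v
    · rintro ⟨⟨⟨h1, hcK, hcc⟩, h0⟩, h3⟩
      have h1 : μ.1 A = (2 * d : ℕ) := h1
      refine ⟨C μ, hcK, hcc, (h.isSeed_iff hcc).2 ⟨h0, ?_, ?_, ?_⟩⟩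
      · rw [← hA, h1]; push_cast; rfl
      · exact (smul_inv_smul₀ hd' _).symm
      · have hcl := μ.2.isClosed_setOf_cap hAm (h1 ▸ hfin) ρ (C μ)
        have := hcl.closure_subset_iff.2 fun v hv => (h3 v hv).2
        rw [hD.closure_eq] at this
        exact fun v => this (mem_univ v)
  rw [this]
  exact (((measurable_apply hAm (measurableSet_singleton _)).inter
    (hC (hK.inter measurableSet_closedBall))).inter (measurableSet_moat_null hC ρ a b T)).inter
    (MeasurableSet.biInter hDc fun v _ => measurableSet_cap_ne_zero hC hAm _ ρ v)

theorem Admissible.measurableSet_exists_seed (h : Admissible ρ a b T) (hd : 1 ≤ d)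
    {K : Set (Space d)} (hK : MeasurableSet K) :
    MeasurableSet {μ : Config d | ∃ c ∈ K, IsSeed ρ a b T μ.1 c} := by
  obtain ⟨D, hDc, hD⟩ := TopologicalSpace.exists_countable_dense (Space d)
  have : {μ : Config d | ∃ c ∈ K, IsSeed ρ a b T μ.1 c} =
      ⋃ c' ∈ D, {μ : Config d | ∃ c ∈ K, dist c c' ≤ ρ / 4 ∧ IsSeed ρ a b T μ.1 c} := by
    ext μ
    simp only [mem_iUnion]
    constructor
    · rintro ⟨c, hcK, hs⟩
      obtain ⟨c', hc', hcc⟩ := hD.exists_dist_lt c (by linarith [h.pos] : 0 < ρ / 4)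
      exact ⟨c', hc', c, hcK, hcc.le, hs⟩
    · rintro ⟨c', -, c, hcK, -, hs⟩
      exact ⟨c, hcK, hs⟩
  rw [this]
  exact MeasurableSet.biUnion hDc fun c' _ => h.measurableSet_exists_seed_near hd c' hK

/-! ### Perturbed cross-polytopes produce seeds -/

/-- The vertices of the cross-polytope of radius `r`. -/
def spoke {d : ℕ} (r : ℝ) (p : Fin d × Bool) : Space d :=
  EuclideanSpace.single p.1 (if p.2 then r else -r)

theorem norm_spoke (hr : 0 ≤ r) (p : Fin d × Bool) : ‖spoke r p‖ = r := by
  unfold spoke; split_ifs <;> simp [abs_of_nonneg hr]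

theorem sum_spoke (d : ℕ) (r : ℝ) : ∑ p : Fin d × Bool, spoke r p = 0 := by
  rw [Fintype.sum_prod_type]
  refine Finset.sum_eq_zero fun i _ => ?_
  ext j
  simp [spoke]
  split_ifs <;> simp

theorem le_dist_spoke (hr : 0 ≤ r) {p q : Fin d × Bool} (hpq : p ≠ q) :
    r ≤ dist (spoke r p) (spoke r q) := by
  rw [dist_eq_norm]
  refine le_trans ?_ (PiLp.norm_apply_le (spoke r p - spoke r q) p.1)
  obtain ⟨i, σ⟩ := p
  obtain ⟨j, τ⟩ := q
  by_cases hij : i = j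
  · subst hij
    have hst : σ ≠ τ := fun h => hpq (by rw [h])
    cases σ <;> cases τ <;> simp_all [spoke]
    · rw [abs_of_nonpos (by linarith)]; linarith
    · rw [abs_of_nonneg (by linarith)]; linarith
  · cases σ <;> simp [spoke, hij, abs_of_nonneg hr]

/-- Choose the vertex along the largest coordinate of `v`, with matching sign; that coordinate is at
least `‖v‖ / d` in absolute value. -/
theorem exists_inner_spoke_ge (hd : 1 ≤ d) (hr : 0 ≤ r) (v : Space d) :
    ∃ p : Fin d × Bool, r * ‖v‖ ≤ d * inner ℝ (spoke r p) v := by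
  have : Nonempty (Fin d) := ⟨⟨0, hd⟩⟩
  obtain ⟨i, -, hi⟩ := Finset.exists_max_image Finset.univ (fun i => |v i|) Finset.univ_nonempty
  have hd' : (1 : ℝ) ≤ d := by exact_mod_cast hd
  have hv : ‖v‖ ≤ d * |v i| := by
    refine le_of_sq_le_sq ?_ (by positivity)
    rw [EuclideanSpace.norm_sq_eq]
    calc ∑ j, ‖v j‖ ^ 2 ≤ ∑ _j : Fin d, |v i| ^ 2 :=
          Finset.sum_le_sum fun j hj => pow_le_pow_left₀ (norm_nonneg _) (hi j hj) 2
      _ = d * |v i| ^ 2 := by simp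
      _ ≤ (d * |v i|) ^ 2 := by
          rw [mul_pow]
          exact mul_le_mul_of_nonneg_right (by nlinarith) (by positivity)
  have hv' := mul_le_mul_of_nonneg_left hv hr
  refine ⟨(i, decide (0 ≤ v i)), hv'.trans (le_of_eq ?_)⟩
  rw [spoke, EuclideanSpace.inner_single_left]
  by_cases h : 0 ≤ v i
  · simp [h, abs_of_nonneg h]; ring
  · simp [h, abs_of_neg (not_le.1 h)]; ring

/-- The small balls about the vertices of the cross-polytope centred at `z`, together with the
rest of the ball of radius `T` about `z`. -/
def pattern {d : ℕ} (r ε T : ℝ) (z : Space d) : Option (Fin d × Bool) → Set (Space d)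
  | some p => ball (z + spoke r p) ε
  | none => ball z T \ ⋃ p : Fin d × Bool, ball (z + spoke r p) ε

theorem measurableSet_pattern (r ε T : ℝ) (z : Space d) (p : Option (Fin d × Bool)) :
    MeasurableSet (pattern r ε T z p) := by
  cases p with
  | none => exact measurableSet_ball.diff (MeasurableSet.iUnion fun _ => measurableSet_ball)
  | some p => exact measurableSet_ball

theorem pattern_subset_ball (hr : 0 ≤ r) (hT : r + ε ≤ T) (z : Space d)
    (p : Option (Fin d × Bool)) : pattern r ε T z p ⊆ ball z T := by
  cases p with
  | none => exact sdiff_subset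
  | some p =>
    refine ball_subset_ball' ?_
    rw [dist_eq_norm, add_sub_cancel_left, norm_spoke hr]
    linarith

theorem pairwise_disjoint_ball_spoke (hr : 0 ≤ r) (hε : 2 * ε ≤ r) (z : Space d) :
    Pairwise fun p q : Fin d × Bool =>
      Disjoint (ball (z + spoke r p) ε) (ball (z + spoke r q) ε) := fun p q hpq =>
  ball_disjoint_ball (by rw [dist_add_left]; linarith [le_dist_spoke hr hpq])

theorem pairwise_disjoint_pattern (hr : 0 ≤ r) (hε : 2 * ε ≤ r) (T : ℝ) (z : Space d) :
    Pairwise fun p q => Disjoint (pattern r ε T z p) (pattern r ε T z q) := by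
  have hn : ∀ p, Disjoint (pattern r ε T z none) (pattern r ε T z (some p)) := fun p =>
    disjoint_sdiff_left.mono_right (subset_iUnion (fun p => ball (z + spoke r p) ε) p)
  intro p q hpq
  cases p with
  | none => cases q with
    | none => exact absurd rfl hpq
    | some q => exact hn q
  | some p => cases q with
    | none => exact (hn p).symm
    | some q => exact pairwise_disjoint_ball_spoke hr hε z fun h => hpq (congrArg some h)

theorem norm_setIntegral_sub_le (hμ : μ (ball z ε) = 1) :
    ‖∫ x in ball z ε, x ∂μ - z‖ ≤ ε := by
  have hint : IntegrableOn (fun x : Space d => x) (ball z ε) μ :=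
    integrableOn_id_of_isBounded isBounded_ball measurableSet_ball (by simp [hμ])
  have h1 : ∫ x in ball z ε, (x - z) ∂μ = ∫ x in ball z ε, x ∂μ - z := by
    rw [integral_sub hint (integrableOn_const (by simp [hμ])), setIntegral_const, measureReal_def,
      hμ]
    simp
  rw [← h1]
  refine (norm_setIntegral_le_of_norm_le_const (C := ε) (by simp [hμ]) fun x hx => ?_).trans ?_
  · rw [← dist_eq_norm]; exact (mem_ball.1 hx).le
  · simp [measureReal_def, hμ]

/-- A configuration with exactly one point near each vertex of a large cross-polytope and no other
points nearby has a seed. -/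
theorem Admissible.exists_isSeed_of_pattern (hd : 1 ≤ d) (h : Admissible ρ (r - 2 * ε) (r + 2 * ε) T)
    (hε : 0 < ε) (hερ : 8 * ε ≤ ρ) (hr : 4 * ρ * d ≤ r)
    (h0 : μ (pattern r ε (T + ε) z none) = 0) (h1 : ∀ p, μ (pattern r ε (T + ε) z (some p)) = 1) :
    ∃ c, IsSeed ρ (r - 2 * ε) (r + 2 * ε) T μ c := by
  have hd' : (1 : ℝ) ≤ d := by exact_mod_cast hd
  have hρ := h.pos
  have hr0 : 4 * ρ ≤ r := le_trans (by nlinarith) hr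
  have hT := h.four_mul_le
  set B : Fin d × Bool → Set (Space d) := fun p => ball (z + spoke r p) ε
  replace h1 : ∀ p, μ (B p) = 1 := h1
  have hBdisj := pairwise_disjoint_ball_spoke (d := d) (by linarith) (by linarith : 2 * ε ≤ r) z
  have hBm : ∀ p, MeasurableSet (B p) := fun p => measurableSet_ball
  have hBdist : ∀ p, ∀ x ∈ B p, r - ε < dist x z ∧ dist x z < r + ε := by
    intro p x hx
    have h2 : dist (z + spoke r p) z = r := by
      rw [dist_eq_norm, add_sub_cancel_left, norm_spoke (by linarith)]
    have h3 := dist_triangle x (z + spoke r p) z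
    have h4 := dist_triangle (z + spoke r p) x z
    rw [dist_comm _ x] at h4
    have h5 : dist x (z + spoke r p) < ε := hx
    exact ⟨by linarith, by linarith⟩
  set A := shell (r - 2 * ε - ρ / 4) (r + 2 * ε + ρ / 4) z with hA
  have hBA : ∀ p, B p ⊆ A := fun p x hx =>
    ⟨by linarith [(hBdist p x hx).1], by linarith [(hBdist p x hx).2]⟩
  -- Outside the small balls, the shell lies in the empty `none` part of the pattern.
  have hae : A =ᵐ[μ] ⋃ p, B p := by
    refine ae_eq_set.2 ⟨measure_mono_null (fun x hx => ?_) h0, ?_⟩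
    · refine ⟨?_, hx.2⟩
      rw [mem_ball]
      linarith [hx.1.2]
    · rw [sdiff_eq_empty.2 (iUnion_subset hBA), measure_empty]
  have hmass : μ A = 2 * d := by
    rw [measure_congr hae, measure_iUnion hBdisj hBm, tsum_fintype]
    change ∑ p, μ (B p) = _
    simp [h1, mul_comm]
  have hint : ∀ p, IntegrableOn (fun x : Space d => x) (B p) μ := fun p =>
    integrableOn_id_of_isBounded isBounded_ball (hBm p) (by simp [h1 p])
  have hI : ‖∫ x in A, x ∂μ - (2 * d : ℝ) • z‖ ≤ 2 * d * ε := by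
    have hsum : ∫ x in A, x ∂μ - (2 * d : ℝ) • z =
        ∑ p, (∫ x in B p, x ∂μ - (z + spoke r p)) := by
      rw [Finset.sum_sub_distrib, Finset.sum_add_distrib, sum_spoke, setIntegral_congr_set hae,
        integral_iUnion_fintype hBm hBdisj hint]
      simp [mul_comm, ← Nat.cast_smul_eq_nsmul ℝ]
    rw [hsum]
    refine (norm_sum_le_of_le _ fun p _ => norm_setIntegral_sub_le (h1 p)).trans ?_
    simp [mul_comm]
  set c : Space d := (2 * d : ℝ)⁻¹ • ∫ x in A, x ∂μ with hc
  have hcI : ∫ x in A, x ∂μ = (2 * d : ℝ) • c := by rw [hc, smul_inv_smul₀ (by positivity)]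
  -- The vertices sum to zero and each point is displaced by at most `ε`, so the barycentre moves by
  -- at most `ε`. This is why the shell has half-width `2 * ε` and the pattern reaches out to `T +
  -- ε`.
  have hcz : dist c z ≤ ε := by
    rw [hcI, ← smul_sub, norm_smul, ← dist_eq_norm, Real.norm_of_nonneg (by positivity)] at hI
    exact le_of_mul_le_mul_left hI (by positivity)
  have hdist : ∀ x, dist x z ≤ dist x c + ε ∧ dist x c ≤ dist x z + ε := fun x => by
    have h2 := dist_triangle x c z
    have h3 := dist_triangle x z c
    rw [dist_comm z c] at h3
    exact ⟨by linarith, by linarith⟩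
  refine ⟨c, (h.isSeed_iff (c' := z) (by linarith)).2
    ⟨measure_mono_null (fun x hx => ?_) h0, hmass, hcI, fun v => ?_⟩⟩
  · refine ⟨?_, fun hxB => ?_⟩
    · rw [mem_ball]
      linarith [hx.1.2, (hdist x).1]
    · obtain ⟨p, hp⟩ := mem_iUnion.1 hxB
      have h2 := hBdist p x hp
      have h3 := hdist x
      exact hx.2 ⟨by linarith, by linarith⟩
  · obtain ⟨p, hp⟩ := exists_inner_spoke_ge hd (by linarith : 0 ≤ r) v
    -- The vertex clears the cap threshold by a factor of two; the margin pays for the two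
    -- displacements by `ε`, of the point and of the centre.
    have hp' : 4 * ρ * ‖v‖ ≤ inner ℝ (spoke r p) v := by
      refine le_of_mul_le_mul_left (le_trans ?_ hp) (by positivity : (0 : ℝ) < d)
      nlinarith [norm_nonneg v]
    have hsub : B p ⊆ A ∩ cap ρ c v := fun x hx => by
      refine ⟨hBA p hx, ?_⟩
      change 2 * ρ * ‖v‖ ≤ inner ℝ (x - c) v
      have hx' : ‖x - (z + spoke r p)‖ ≤ ε := by
        rw [← dist_eq_norm]; exact (mem_ball.1 hx).le
      rw [dist_eq_norm] at hcz
      have h2 := neg_le_of_abs_le (abs_real_inner_le_norm (x - (z + spoke r p)) v)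
      have h3 := le_of_abs_le (abs_real_inner_le_norm (c - z) v)
      have h4 : x - c = (x - (z + spoke r p)) + spoke r p - (c - z) := by abel
      rw [h4, inner_sub_left, inner_add_left]
      nlinarith [norm_nonneg v, mul_le_mul_of_nonneg_right hx' (norm_nonneg v),
        mul_le_mul_of_nonneg_right hcz (norm_nonneg v),
        mul_le_mul_of_nonneg_right hερ (norm_nonneg v)]
    intro h2
    have := measure_mono_null hsub h2
    rw [h1 p] at this
    exact one_ne_zero this

/-! ### Almost sure occurrence of the pattern -/

variable {lam : ℝ≥0} {P : Measure (Config d)}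

theorem IsPoissonLaw.iIndepFun (hP : IsPoissonLaw lam P) {ι : Type*} {B : ι → Set (Space d)}
    (hB : ∀ i, MeasurableSet (B i)) (hdisj : Pairwise fun i j => Disjoint (B i) (B j)) :
    iIndepFun (fun i (μ : Config d) => μ.1 (B i)) P := by
  refine iIndepFun_iff_finset.2 fun s => ?_
  have h := hP.indep s.card (fun k => B (s.equivFin.symm k)) (fun _ => hB _) fun i j hij =>
    hdisj fun h => hij (s.equivFin.symm.injective (Subtype.ext h))
  have h' := h.precomp s.equivFin.injective
  simpa only [Equiv.symm_apply_apply] using! h'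

theorem IsPoissonLaw.measure_count_eq (hP : IsPoissonLaw lam P) {B : Set (Space d)}
    (hB : MeasurableSet B) (hfin : volume B ≠ ∞) (n : ℕ) :
    P ((fun μ : Config d => μ.1 B) ⁻¹' {(n : ℝ≥0∞)}) =
      poissonMeasure (lam * (volume B).toNNReal) {n} := by
  rw [← Measure.map_apply (measurable_apply hB) (measurableSet_singleton _),
    hP.map_count B hB hfin, Measure.map_apply (by fun_prop) (measurableSet_singleton _)]
  congr 1
  ext m
  simp

/-- The event that the points of the configuration follow the pattern about `z`. -/
def patternEvent {d : ℕ} (r ε T : ℝ) (z : Space d) : Set (Config d) :=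
  ⋂ p, (fun μ : Config d => μ.1 (pattern r ε T z p)) ⁻¹' {((p.elim 0 fun _ => 1 : ℕ) : ℝ≥0∞)}

theorem measurableSet_patternEvent (r ε T : ℝ) (z : Space d) :
    MeasurableSet (patternEvent r ε T z) :=
  MeasurableSet.iInter fun p =>
    measurable_apply (measurableSet_pattern r ε T z p) (measurableSet_singleton _)

/-- All cells of all windows form one disjoint family indexed by pairs, so a single use of
independence factorises both across windows and within each. -/
theorem IsPoissonLaw.measure_biInter_patternEvent (hP : IsPoissonLaw lam P) (hr : 0 ≤ r)
    (hε : 2 * ε ≤ r) (hT : r + ε ≤ T) {z : ℕ → Space d}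
    (hz : Pairwise fun k l => T + T ≤ dist (z k) (z l)) (s : Finset ℕ) :
    P (⋂ k ∈ s, patternEvent r ε T (z k)) = ∏ k ∈ s, ∏ p,
      P ((fun μ : Config d => μ.1 (pattern r ε T (z k) p)) ⁻¹'
        {((p.elim 0 fun _ => 1 : ℕ) : ℝ≥0∞)}) := by
  have hdisj : Pairwise fun i j : ℕ × Option (Fin d × Bool) =>
      Disjoint (pattern r ε T (z i.1) i.2) (pattern r ε T (z j.1) j.2) := by
    rintro ⟨k, p⟩ ⟨l, q⟩ hne
    by_cases hkl : k = l
    · subst hkl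
      exact pairwise_disjoint_pattern hr hε T (z k) fun h =>
        hne (congrArg (Prod.mk k) h)
    · exact (ball_disjoint_ball (hz hkl)).mono (pattern_subset_ball hr hT _ _)
        (pattern_subset_ball hr hT _ _)
  have h := (hP.iIndepFun (fun i : ℕ × Option (Fin d × Bool) =>
    measurableSet_pattern r ε T (z i.1) i.2) hdisj).measure_inter_preimage_eq_mul
      (s ×ˢ Finset.univ) (sets := fun i => {((i.2.elim 0 fun _ => 1 : ℕ) : ℝ≥0∞)})
      fun i _ => measurableSet_singleton _
  rw [Finset.prod_product] at h
  rw [← h]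
  congr 1
  ext μ
  simp only [patternEvent, mem_iInter, Finset.mem_product, Finset.mem_univ, and_true]
  exact ⟨fun h i hi => h i.1 hi i.2, fun h k hk p => h (k, p) hk⟩

/-- The bound is uniform in `z` by translation invariance of volume; the void probability is
estimated from below by that of the whole ball. -/
theorem IsPoissonLaw.exists_le_measure_patternEvent (hP : IsPoissonLaw lam P) (hlam : 0 < lam)
    (hr : 0 ≤ r) (hε0 : 0 < ε) (hT : r + ε ≤ T) :
    ∃ q : ℝ≥0∞, q ≠ 0 ∧ ∀ z : Space d, q ≤ ∏ p,
      P ((fun μ : Config d => μ.1 (pattern r ε T z p)) ⁻¹'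
        {((p.elim 0 fun _ => 1 : ℕ) : ℝ≥0∞)}) := by
  have hlam' : (0 : ℝ) < lam := hlam
  set v : ℝ≥0 := lam * (volume (ball (0 : Space d) ε)).toNNReal with hv
  set w : ℝ≥0 := lam * (volume (ball (0 : Space d) T)).toNNReal with hw
  have hvpos : 0 < v := mul_pos hlam
    (ENNReal.toNNReal_pos (measure_ball_pos volume _ hε0).ne' measure_ball_lt_top.ne)
  refine ⟨ENNReal.ofReal (Real.exp (-w)) * ∏ _p : Fin d × Bool, poissonMeasure v {1}, ?_,
    fun z => ?_⟩
  · refine mul_ne_zero (by simpa using Real.exp_pos _) (Finset.prod_ne_zero_iff.2 fun _ _ => ?_)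
    rw [poissonMeasure_singleton, Ne, ENNReal.ofReal_eq_zero, not_le]
    have : (0 : ℝ) < v := hvpos
    positivity
  · rw [Fintype.prod_option]
    have hsub := pattern_subset_ball (d := d) hr hT z none
    refine mul_le_mul' ?_ (Finset.prod_le_prod' fun p _ => ?_)
    · rw [hP.measure_count_eq (measurableSet_pattern r ε T z none)
        (measure_lt_top_mono hsub measure_ball_lt_top).ne, poissonMeasure_singleton]
      refine ENNReal.ofReal_le_ofReal ?_
      simp only [Option.elim_none, pow_zero, mul_one, Nat.factorial_zero, Nat.cast_one, div_one]
      refine Real.exp_le_exp.2 (neg_le_neg (NNReal.coe_le_coe.2 (mul_le_mul_right ?_ lam)))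
      refine ENNReal.toNNReal_mono measure_ball_lt_top.ne ?_
      rw [← Measure.addHaar_ball_center volume z]
      exact measure_mono hsub
    · rw [hP.measure_count_eq (measurableSet_pattern r ε T z (some p)) measure_ball_lt_top.ne]
      simp only [pattern, Option.elim_some]
      rw [Measure.addHaar_ball_center]

theorem exists_seq_le_dist (hd : 1 ≤ d) (L : ℝ) (hL : 0 ≤ L) :
    ∃ z : ℕ → Space d, Pairwise fun k l => L ≤ dist (z k) (z l) := by
  refine ⟨fun k => EuclideanSpace.single ⟨0, hd⟩ (k * L), fun k l hkl => ?_⟩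
  change L ≤ dist (EuclideanSpace.single _ _) (EuclideanSpace.single _ _)
  rw [PiLp.dist_single_same, Real.dist_eq, ← sub_mul, abs_mul, abs_of_nonneg hL]
  have : (1 : ℝ) ≤ |(k : ℝ) - l| := by
    have : (1 : ℤ) ≤ |(k : ℤ) - l| := Int.one_le_abs (by omega)
    exact_mod_cast this
  nlinarith

/-- Under a Poisson law of positive intensity the pattern occurs somewhere almost surely. -/
theorem IsPoissonLaw.ae_exists_patternEvent (hd : 1 ≤ d) (hP : IsPoissonLaw lam P)
    (hlam : 0 < lam) (hε0 : 0 < ε) (hε : 2 * ε ≤ r) (hT : r + ε ≤ T) :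
    ∀ᵐ μ ∂P, ∃ z, μ ∈ patternEvent r ε T z := by
  have := hP.isProbabilityMeasure
  obtain ⟨z, hz⟩ := exists_seq_le_dist hd (T + T) (by linarith)
  have hbi := hP.measure_biInter_patternEvent (by linarith) hε hT hz
  obtain ⟨q, hq0, hq⟩ := hP.exists_le_measure_patternEvent hlam (by linarith : 0 ≤ r) hε0 hT
  have hone : ∀ k, P (patternEvent r ε T (z k)) = ∏ p,
      P ((fun μ : Config d => μ.1 (pattern r ε T (z k) p)) ⁻¹'
        {((p.elim 0 fun _ => 1 : ℕ) : ℝ≥0∞)}) := fun k => by simpa using hbi {k}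
  have hm : ∀ k, MeasurableSet (patternEvent r ε T (z k)) := fun k =>
    measurableSet_patternEvent r ε T (z k)
  -- Second Borel–Cantelli lemma: the events are independent with probabilities bounded below by
  -- `q`, so their sum diverges.
  have hlim : P (limsup (fun k => patternEvent r ε T (z k)) atTop) = 1 := by
    refine measure_limsup_eq_one hm ((iIndepSet_iff_meas_biInter hm).2 fun s => ?_) ?_
    · simp_rw [hbi, hone]
    · refine top_le_iff.1 ?_
      rw [← ENNReal.tsum_const_eq_top_of_ne_zero (α := ℕ) hq0]
      exact ENNReal.tsum_le_tsum fun k => (hone k).symm ▸ hq (z k)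
  have hae := (mem_ae_iff_prob_eq_one (MeasurableSet.measurableSet_limsup hm)).2 hlim
  filter_upwards [hae] with μ hμ
  obtain ⟨k, hk⟩ := (mem_limsup_iff_frequently_mem.1 hμ).exists
  exact ⟨z k, hk⟩

/-! ### Choice of radii and the selection rule -/

/-- Here `b ^ 2 - a ^ 2 = 8 * r * ε`, so the factor `512` makes `thin` an equality, and `T` makes
`sq_le` one. Then `four_mul_le` amounts to `4 * ρ ≤ b`, which holds since `r ≥ 4 * ρ`. -/
theorem admissible_scale (hd : 1 ≤ d) (hρ : 0 < ρ) (hr : r = 4 * d * ρ)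
    (hε : ε = ρ / (512 * d)) :
    Admissible ρ (r - 2 * ε) (r + 2 * ε) ((r + 2 * ε) ^ 2 / ρ) := by
  have hd' : (1 : ℝ) ≤ d := by exact_mod_cast hd
  have hεd : 512 * d * ε = ρ := by rw [hε]; field_simp
  have hε0 : 0 < ε := by rw [hε]; positivity
  have hερ : 512 * ε ≤ ρ := by nlinarith
  have hrρ : 4 * ρ ≤ r := by nlinarith
  refine ⟨hρ, by linarith, by linarith, le_of_eq ?_, ?_, le_of_eq ?_⟩
  · rw [hr, ← hεd]; ring
  · rw [le_div_iff₀ hρ]; nlinarith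
  · field_simp

/-- Seeds form a closed set. -/
theorem Admissible.isClosed_setOf_isSeed (h : Admissible ρ a b T) (hd : 1 ≤ d)
    (μ : Measure (Space d)) : IsClosed {c | IsSeed ρ a b T μ c} := by
  have : 0 < T + ρ := by linarith [h.pos, h.two_mul_le, h.le, h.four_mul_le]
  exact isClosed_of_pairwise_le_dist this fun c hc c' hc' hne => h.le_dist_of_ne hd hc hc' hne

/-- The union of the closed balls of radius `R` about the seeds of a configuration. -/
def selection {d : ℕ} (R ρ a b T : ℝ) (μ : Config d) : ClosedSets d :=
  ⟨cthickening R {c | IsSeed ρ a b T μ.1 c}, isClosed_cthickening⟩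

theorem Admissible.coe_selection (h : Admissible ρ a b T) (hd : 1 ≤ d) {R : ℝ} (hR : 0 ≤ R)
    (μ : Config d) : (selection R ρ a b T μ : Set (Space d)) =
      ⋃ c ∈ {c | IsSeed ρ a b T μ.1 c}, closedBall c R :=
  (h.isClosed_setOf_isSeed hd μ.1).cthickening_eq_biUnion_closedBall hR

theorem Admissible.selection_map (h : Admissible ρ a b T) (hd : 1 ≤ d) {R : ℝ} (hR : 0 ≤ R)
    (θ : Space d ≃ᵢ Space d) (μ : Config d) :
    (selection R ρ a b T (μ.map θ) : Set (Space d)) = θ '' (selection R ρ a b T μ) := by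
  rw [h.coe_selection hd hR, h.coe_selection hd hR, image_iUnion₂]
  simp_rw [θ.image_closedBall]
  have : {c | IsSeed ρ a b T (μ.map θ).1 c} = θ '' {c | IsSeed ρ a b T μ.1 c} := by
    rw [← IsometryEquiv.preimage_symm]
    ext c
    exact isSeed_map_iff θ
  rw [this, biUnion_image]

/-- The selected set meets a compact `K` exactly when some seed lies in the closed `R`-thickening of
`K`. -/
theorem Admissible.measurable_selection (h : Admissible ρ a b T) (hd : 1 ≤ d) {R : ℝ}
    (hR : 0 ≤ R) : Measurable (selection (d := d) R ρ a b T) := by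
  refine measurable_generateFrom ?_
  rintro _ ⟨K, hK, rfl⟩
  have : selection R ρ a b T ⁻¹' {F : ClosedSets d | ((F : Set (Space d)) ∩ K).Nonempty} =
      {μ : Config d | ∃ c ∈ cthickening R K, IsSeed ρ a b T μ.1 c} := by
    ext μ
    change ((selection R ρ a b T μ : Set (Space d)) ∩ K).Nonempty ↔
      ∃ c ∈ cthickening R K, IsSeed ρ a b T μ.1 c
    rw [h.coe_selection hd hR, hK.cthickening_eq_biUnion_closedBall hR]
    simp only [Set.Nonempty, mem_inter_iff, mem_iUnion, exists_prop, mem_closedBall]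
    constructor
    · rintro ⟨x, ⟨c, hc, hx⟩, hxK⟩
      exact ⟨c, ⟨x, hxK, dist_comm x c ▸ hx⟩, hc⟩
    · rintro ⟨c, ⟨x, hxK, hx⟩, hc⟩
      exact ⟨x, ⟨c, hc, dist_comm x c ▸ hx⟩, hxK⟩
  rw [this]
  exact h.measurableSet_exists_seed hd isClosed_cthickening.measurableSet

theorem dist_le_of_notMem_outside {F : ClosedSets d} {R : ℝ} {C : Set (Space d)}
    (hF : (F : Set (Space d)) = ⋃ c ∈ C, closedBall c R) {x : Space d} (hx : x ∉ outside F) :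
    ∃ c ∈ C, dist x c ≤ R + 2 := by
  rw [outside, notMem_compl_iff, hF] at hx
  simp only [mem_iUnion, exists_prop, mem_closedBall] at hx
  obtain ⟨y, ⟨c, hc, hy⟩, hxy⟩ := hx
  exact ⟨c, hc, by linarith [dist_triangle x y c]⟩

theorem Admissible.selection_determined {R : ℝ} (hR : 0 ≤ R) (h : Admissible (R + 2) a b T)
    (hd : 1 ≤ d) (μ μ' : Config d)
    (hμ : μ.1.restrict (outside (selection R (R + 2) a b T μ)) =
      μ'.1.restrict (outside (selection R (R + 2) a b T μ))) :
    selection R (R + 2) a b T μ = selection R (R + 2) a b T μ' := by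
  have ha : R + 2 < a := by linarith [h.pos, h.two_mul_le]
  have hb : b < T := by linarith [h.pos, h.two_mul_le, h.le, h.four_mul_le]
  -- A removed point is within `R + 2` of some seed of `μ`: not of `c`, by the inner radius of the
  -- annulus, and not of another seed, which is at distance at least `T + (R + 2)` from `c`.
  have hout : ∀ x c : Space d, dist x c ∈ Ioo (R + 2) T →
      (∀ c', IsSeed (R + 2) a b T μ.1 c' → c ≠ c' → T + (R + 2) ≤ dist c c') →
      x ∈ outside (selection R (R + 2) a b T μ) := by
    intro x c hx hc
    by_contra hn
    obtain ⟨c', hc', hx'⟩ := dist_le_of_notMem_outside (h.coe_selection hd hR μ) hn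
    by_cases hcc : c = c'
    · subst hcc
      exact absurd hx.1 (not_lt.2 hx')
    · have := hc c' hc' hcc
      have := dist_triangle c x c'
      rw [dist_comm c x] at this
      linarith [hx.2]
  have hsub : ∀ c, IsSeed (R + 2) a b T μ.1 c → IsSeed (R + 2) a b T μ'.1 c := fun c hc =>
    hc.congr ha hb (fun x hx => hout x c hx fun c' hc' hne => h.le_dist_of_ne hd hc hc' hne) hμ
  -- The set removed is defined by `μ`, so separation is needed between a seed of `μ'` and the seeds
  -- of `μ`. By `hsub` the latter are also seeds of `μ'`, so separation within `μ'` applies.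
  have hsup : ∀ c, IsSeed (R + 2) a b T μ'.1 c → IsSeed (R + 2) a b T μ.1 c := fun c hc =>
    hc.congr ha hb (fun x hx => hout x c hx fun c' hc' hne =>
      h.le_dist_of_ne hd hc (hsub c' hc') hne) hμ.symm
  have : {c | IsSeed (R + 2) a b T μ.1 c} = {c | IsSeed (R + 2) a b T μ'.1 c} :=
    Subset.antisymm hsub hsup
  simp only [selection, this]

theorem isSelectionRule_selection (hd : 1 ≤ d) {R : ℝ} (hR : 0 ≤ R)
    (hr : r = 4 * d * (R + 2)) (hε : ε = (R + 2) / (512 * d))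
    (hT : T = (r + 2 * ε) ^ 2 / (R + 2)) :
    IsSelectionRule R (selection (d := d) R (R + 2) (r - 2 * ε) (r + 2 * ε) T) := by
  have hd' : (1 : ℝ) ≤ d := by exact_mod_cast hd
  have h : Admissible (R + 2) (r - 2 * ε) (r + 2 * ε) T :=
    hT ▸ admissible_scale hd (by linarith) hr hε
  have hε0 : 0 < ε := by rw [hε]; positivity
  have hεd : 512 * d * ε = R + 2 := by rw [hε]; field_simp
  have hερ : 8 * ε ≤ R + 2 := by nlinarith
  have hrρ : 4 * (R + 2) ≤ r := by nlinarith
  have hT4 := h.four_mul_le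
  refine ⟨fun lam hlam P hP => ?_, h.selection_map hd hR, h.selection_determined hR hd,
    h.measurable_selection hd hR⟩
  filter_upwards [hP.ae_exists_patternEvent (T := T + ε) hd hlam hε0 (by linarith : 2 * ε ≤ r)
    (by linarith)] with μ ⟨z, hz⟩
  have hz := mem_iInter.1 hz
  refine ⟨{c | IsSeed (R + 2) (r - 2 * ε) (r + 2 * ε) T μ.1 c}, ?_, ?_, h.coe_selection hd hR μ⟩
  · exact h.exists_isSeed_of_pattern hd hε0 hερ (by rw [hr]; linarith)
      (by simpa using! hz none) fun p => by simpa using! hz (some p)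
  · intro c hc c' hc' hne
    exact closedBall_disjoint_closedBall (by linarith [h.le_dist_of_ne hd hc hc' hne])

end PointProc

end

theorem mainTheorem7 (d : ℕ) (hd : 1 ≤ d) (R : ℝ) (hR : 0 < R) :
    ∃ Ψ : PointProc.Config d → PointProc.ClosedSets d, PointProc.IsSelectionRule R Ψ :=
  ⟨_, PointProc.isSelectionRule_selection hd hR.le rfl rfl rfl⟩
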